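/- All graphs are finite, simple and undirected. For a connected graph $G$ with at least one edge, let $\kappa(G)$ denote Kemeny's constant of the simple random walk on $G$, that is, $\kappa(G)=\sum_{j\ne i} m_{i,j}w_j$ (independent of the vertex $i$), where $m_{i,j}$ is the mean first passage time from $i$ to $j$ and $w$ is the stationary distribution. For a vertex $v$ of $G$ and integers $k_1,k_2\ge 0$ with $k_1+k_2\ge 2$, let $\widetilde G(v,k_1,k_2)$ be the graph obtained from $G$ and two disjoint paths $(v_1,\dots,v_{k_1+1})$ and $(w_1,\dots,w_{k_2+1})$ by identifying the vertices $v$, $v_1$ and $w_1$, and let $\widehat G(v,k_1,k_2)$ be obtained from $\widetilde G(v,k_1,k_2)$ by inserting the edge $v_{k_1+1}\sim w_{k_2+1}$. The graph $G$ is $(v,k_1,k_2)$-paradoxical if $\kappa(\widehat G(v,k_1,k_2))>\kappa(\widetilde G(v,k_1,k_2))$. Let $\mathcal T_1,\mathcal T_2,\dots$ be a sequence of trees with a specified vertex $v$ such that $V(\mathcal T_1)=\{v\}$ and, for each $n\ge 2$, $\mathcal T_n$ is obtained from $\mathcal T_{n-1}$ by adding a new pendent vertex (adjacent to exactly one vertex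 of $\mathcal T_{n-1}$) or by subdividing an edge of $\mathcal T_{n-1}$ into two edges through a new vertex. Suppose that $\mathrm{diam}(\mathcal T_n)=\omega(n^{2/3})$ as $n\to\infty$, i.e. $n^{2/3}=o(\mathrm{diam}(\mathcal T_n))$. Then the sequence is asymptotically paradoxical: for all integers $k_1,k_2\ge 0$ with $k_1+k_2\ge 2$ there exists $N>0$ such that $\mathcal T_n$ is $(v,k_1,k_2)$-paradoxical for all $n\ge N$. -/

import Mathlib

open scoped NNReal ENNReal

noncomputable section

namespace Kemeny

/-! ### Kemeny's constant of a finite Markov chain -/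

section Chain

variable {V : Type*} [Fintype V]

open Classical in
/-- For the chain with transition matrix `M` started at `i`, the probability that the first
passage time `T = min {t ≥ 1 : X t = j}` to the state `j` exceeds `t`. -/
def survivalProb (M : Matrix V V ℝ≥0) (j : V) : ℕ → V → ℝ≥0
  | 0, _ => 1
  | t + 1, i => ∑ k ∈ Finset.univ.erase j, M i k * survivalProb M j t k

/-- The mean first passage time from `i` to `j`, as the expectation `∑ t ≥ 0, P(T > t)` of the
first passage time `T` (a positive integer or `∞`). -/
def meanFirstPassage (M : Matrix V V ℝ≥0) (i j : V) : ℝ≥0∞ :=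
  ∑' t : ℕ, (survivalProb M j t i : ℝ≥0∞)

/-- `w` is a stationary distribution of the chain with transition matrix `M`. -/
def IsStationary (M : Matrix V V ℝ≥0) (w : V → ℝ≥0) : Prop :=
  ∑ i, w i = 1 ∧ ∀ j, ∑ i, w i * M i j = w j

open Classical in
/-- `K` is Kemeny's constant of the chain with transition matrix `M`: the sum of
`meanFirstPassage M i j * w j` over the states `j ≠ i` is `K`, for every initial state `i`, where
`w` is the stationary distribution. (For an irreducible chain, in particular for the random walk
on a connected graph, `w` and hence `K` are unique.) -/
def IsKemenyConstant (M : Matrix V V ℝ≥0) (K : ℝ≥0) : Prop :=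
  ∃ w : V → ℝ≥0, IsStationary M w ∧
    ∀ i, ∑ j ∈ Finset.univ.erase i, meanFirstPassage M i j * (w j : ℝ≥0∞) = (K : ℝ≥0∞)

open Classical in
/-- The transition matrix of the simple random walk on `G`. -/
def walkMatrix (G : SimpleGraph V) : Matrix V V ℝ≥0 :=
  Matrix.of fun i j => if G.Adj i j then (G.degree i : ℝ≥0)⁻¹ else 0

end Chain

/-! ### Twin pendent paths -/

section Twin

variable {V : Type*}

/-- Auxiliary relation for `twinPaths`, which symmetrizes it. -/
def twinRel (G : SimpleGraph V) (v : V) (k₁ k₂ : ℕ) :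
    V ⊕ (Fin k₁ ⊕ Fin k₂) → V ⊕ (Fin k₁ ⊕ Fin k₂) → Prop
  | .inl x, .inl y => G.Adj x y
  | .inl x, .inr (.inl i) => x = v ∧ (i : ℕ) = 0
  | .inl x, .inr (.inr j) => x = v ∧ (j : ℕ) = 0
  | .inr (.inl i), .inr (.inl i') => (i : ℕ) + 1 = i'
  | .inr (.inr j), .inr (.inr j') => (j : ℕ) + 1 = j'
  | _, _ => False

/-- The graph obtained from `G` and two paths with `k₁ + 1` and `k₂ + 1` vertices by identifying
the vertex `v` of `G` with the first vertex of each path. The other vertices of the two paths, in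
order, are those coming from `Fin k₁` and from `Fin k₂`. -/
def twinPaths (G : SimpleGraph V) (v : V) (k₁ k₂ : ℕ) : SimpleGraph (V ⊕ (Fin k₁ ⊕ Fin k₂)) :=
  SimpleGraph.fromRel (twinRel G v k₁ k₂)

/-- The last vertex of the first path (the vertex `v` itself if `k₁ = 0`). -/
def firstEnd (v : V) : (k₁ k₂ : ℕ) → V ⊕ (Fin k₁ ⊕ Fin k₂)
  | 0, _ => .inl v
  | k + 1, _ => .inr (.inl (Fin.last k))

/-- The last vertex of the second path (the vertex `v` itself if `k₂ = 0`). -/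
def secondEnd (v : V) : (k₁ k₂ : ℕ) → V ⊕ (Fin k₁ ⊕ Fin k₂)
  | _, 0 => .inl v
  | _, k + 1 => .inr (.inr (Fin.last k))

/-- The graph obtained from `twinPaths G v k₁ k₂` by inserting the edge between the last vertices
of the two paths. -/
def twinPathsClosed (G : SimpleGraph V) (v : V) (k₁ k₂ : ℕ) :
    SimpleGraph (V ⊕ (Fin k₁ ⊕ Fin k₂)) :=
  twinPaths G v k₁ k₂ ⊔ SimpleGraph.edge (firstEnd v k₁ k₂) (secondEnd v k₁ k₂)

/-- `G` is `(v, k₁, k₂)`-paradoxical: inserting the edge between the ends of the twin pendent paths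
at `v` strictly increases Kemeny's constant of the random walk. -/
def IsParadoxicalAt [Fintype V] (G : SimpleGraph V) (v : V) (k₁ k₂ : ℕ) : Prop :=
  ∃ K K' : ℝ≥0,
    IsKemenyConstant (walkMatrix (twinPaths G v k₁ k₂)) K ∧
    IsKemenyConstant (walkMatrix (twinPathsClosed G v k₁ k₂)) K' ∧ K < K'

end Twin

/-- A sequence of graphs `G n` with specified vertices `v n` is asymptotically paradoxical. -/
def AsymptoticallyParadoxical {V : ℕ → Type*} [∀ n, Fintype (V n)]
    (G : ∀ n, SimpleGraph (V n)) (v : ∀ n, V n) : Prop :=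
  ∀ k₁ k₂ : ℕ, 2 ≤ k₁ + k₂ → ∃ N > 0, ∀ n ≥ N, IsParadoxicalAt (G n) (v n) k₁ k₂

/-! ### Growing a graph by one vertex -/

section Growth

variable {V W : Type*}

/-- Add a new pendent vertex `none` to `G`, adjacent to `u` only. -/
def addPendent (G : SimpleGraph V) (u : V) : SimpleGraph (Option V) :=
  G.map Function.Embedding.some ⊔ SimpleGraph.edge none (some u)

/-- Replace the edge between `a` and `b` by two edges joining `a` and `b` to the new vertex
`none`. -/
def subdivideEdge (G : SimpleGraph V) (a b : V) : SimpleGraph (Option V) :=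
  (G.deleteEdges {s(a, b)}).map Function.Embedding.some ⊔
    SimpleGraph.edge none (some a) ⊔ SimpleGraph.edge none (some b)

/-- The graph `H` with specified vertex `w` is, up to an isomorphism that matches the specified
vertices, obtained from `G` with specified vertex `v` by adding a new pendent vertex or by
subdividing an edge. -/
def IsGrowthStep (G : SimpleGraph V) (v : V) (H : SimpleGraph W) (w : W) : Prop :=
  (∃ u : V, ∃ e : addPendent G u ≃g H, e (some v) = w) ∨
  (∃ a b : V, G.Adj a b ∧ ∃ e : subdivideEdge G a b ≃g H, e (some v) = w)

end Growth

/-- `T 1, T 2, …` is a sequence of trees with specified vertices `v 1, v 2, …`: the tree `T 1` has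
the single vertex `v 1`, and each later tree arises from the previous one by a growth step that
keeps the specified vertex. (The entry with index `0` plays no role.) -/
def IsGrowingTreeSequence {V : ℕ → Type*} (T : ∀ n, SimpleGraph (V n)) (v : ∀ n, V n) : Prop :=
  (∀ x : V 1, x = v 1) ∧ ∀ n ≥ 1, IsGrowthStep (T n) (v n) (T (n + 1)) (v (n + 1))

end Kemeny

end

/-! Kemeny's constant of the walk on a graph with degree vector `d` and resistance matrix `R` is
`dᵀRd / (2 vol)` (`IsResistance.isKemenyConstant`). Of `R` one needs only that it is a pseudometric
whose product with the Laplacian is `c 1ᵀ - 2I` for some vector `c`; distances do this for trees and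
paths, and `|x| - x² / (n + 1)` for cycles.

Both graphs to be compared are gluings at `v`: the tree `G` with a path `H`, or with the cycle `H'`
closing that path. Resistances add across a cut vertex, so `dᵀRd` splits into terms of the two
pieces (`IsGluing.energy_eq`). With `m = vol G`, and `E`, `M` the energy and the moment at `v` of
`G`, closing the path raises `vol H` by 2. After clearing denominators the terms in `E` and `M`
favour the cycle by `2 (2 m M - E)`, while the path contributes an opposing term that is only
quadratic in `m` (`IsGluing.kemeny_lt`).

Finally `2 m M - E` is the sum of `d i * d j * (R i v + R j v - R j i)`, twice the Gromov products
at `v`. The far half of a geodesic from `v` of length at least `diam / 2` makes it at least `diam³ /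
32` (`diam_cube_le`). Since `m = 2n - 2`, a diameter growing faster than `n^(2/3)` beats the
quadratic term. -/

noncomputable section

namespace Kemeny

/-! ### First-step equations and mean first passage times -/

section Passage

variable {V : Type*} [Fintype V]

-- Unrolling the first-step equation `t` times leaves `h` averaged over the walks that still avoid
-- `j`, which is at most `B` times the survival probability.
open Classical in
lemma exists_remainder (M : Matrix V V ℝ≥0) (j : V) (h : V → ℝ≥0)
    (hh : ∀ i, h i = 1 + ∑ k ∈ Finset.univ.erase j, M i k * h k) (B : ℝ≥0) (hB : ∀ i, h i ≤ B)
    (t : ℕ) : ∀ i, ∃ r ≤ B * survivalProb M j t i,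
      h i = ∑ s ∈ Finset.range t, survivalProb M j s i + r := by
  induction t with
  | zero => intro i; exact ⟨h i, by simpa [survivalProb] using hB i, by simp⟩
  | succ t ih =>
    choose r hr hhr using ih
    intro i
    refine ⟨∑ k ∈ Finset.univ.erase j, M i k * r k, ?_, ?_⟩
    · simp only [survivalProb, Finset.mul_sum]
      refine Finset.sum_le_sum fun k _ => ?_
      calc M i k * r k ≤ M i k * (B * survivalProb M j t k) := by gcongr; exact hr k
        _ = _ := by ring
    · rw [hh i, Finset.sum_range_succ']
      simp only [survivalProb]
      rw [Finset.sum_comm, add_comm (∑ _ ∈ _, _) (1 : ℝ≥0), add_assoc, ← Finset.sum_add_distrib]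
      congr 1
      refine Finset.sum_congr rfl fun k _ => ?_
      rw [hhr k, mul_add, Finset.mul_sum]

open Classical in
/-- A finite solution of the first-step equations gives the mean first passage times. -/
lemma meanFirstPassage_eq (M : Matrix V V ℝ≥0) (j : V) (h : V → ℝ≥0)
    (hh : ∀ i, h i = 1 + ∑ k ∈ Finset.univ.erase j, M i k * h k) (i : V) :
    meanFirstPassage M i j = h i := by
  set B : ℝ≥0 := ∑ k, h k
  have hB : ∀ i, h i ≤ B := fun i =>
    Finset.single_le_sum (f := h) (fun _ _ => zero_le) (Finset.mem_univ i)
  have key := exists_remainder M j h hh B hB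
  have hle : ∀ t, ∑ s ∈ Finset.range t, survivalProb M j s i ≤ h i := fun t => by
    obtain ⟨r, -, e⟩ := key t i
    rw [e]; exact le_self_add
  have hs : Summable fun t => survivalProb M j t i := NNReal.summable_of_sum_range_le hle
  have h0 := (NNReal.tendsto_atTop_zero_of_summable hs).const_mul B
  rw [mul_zero] at h0
  -- The partial sums are bounded by `h i`, so survival probabilities are summable and tend to 0;
  -- hence the remainder vanishes. Irreducibility is not needed.
  have hlim : ∑' t, survivalProb M j t i = h i := by
    refine le_antisymm (NNReal.tsum_le_of_sum_range_le hle) ?_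
    have h1 := (hs.hasSum.tendsto_sum_nat).add h0
    rw [add_zero] at h1
    refine ge_of_tendsto' h1 fun t => ?_
    obtain ⟨r, hr, e⟩ := key t i
    rw [e]; gcongr
  rw [meanFirstPassage, ← hlim, ENNReal.coe_tsum hs]

end Passage

/-! ### Kemeny's constant from resistances -/

section Resistance

variable {V : Type*} [Fintype V]

open Classical in
/-- The entry of the adjacency matrix of `G`. -/
def wt {V : Type*} (G : SimpleGraph V) (i j : V) : ℝ := if G.Adj i j then 1 else 0

/-- The degree of a vertex, as a real number. -/
def wdeg (G : SimpleGraph V) (i : V) : ℝ := ∑ j, wt G i j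

/-- The sum of the degrees. -/
def vol (G : SimpleGraph V) : ℝ := ∑ i, wdeg G i

/-- The degree-weighted sum of the values `R i v`. -/
def moment (G : SimpleGraph V) (R : V → V → ℝ) (v : V) : ℝ := ∑ i, wdeg G i * R i v

/-- The quadratic form of `R` at the degree vector. -/
def energy (G : SimpleGraph V) (R : V → V → ℝ) : ℝ := ∑ j, wdeg G j * moment G R j

open Classical in
/-- `R` behaves like the matrix of effective resistances of `G`. -/
structure IsResistance (G : SimpleGraph V) (R : V → V → ℝ) : Prop where
  symm : ∀ i j, R i j = R j i
  self : ∀ i, R i i = 0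
  triangle : ∀ i j k, R i k ≤ R i j + R j k
  laplace : ∃ c : V → ℝ, ∀ i j, ∑ k, wt G i k * (R i j - R k j) = c i - if i = j then 2 else 0

lemma wt_symm {V : Type*} (G : SimpleGraph V) (i j : V) : wt G i j = wt G j i := by
  have h := G.adj_comm i j
  unfold wt
  split_ifs <;> tauto

lemma wt_nonneg {V : Type*} (G : SimpleGraph V) (i j : V) : 0 ≤ wt G i j := by
  unfold wt; split_ifs <;> norm_num

lemma wdeg_nonneg (G : SimpleGraph V) (i : V) : 0 ≤ wdeg G i :=
  Finset.sum_nonneg fun _ _ => wt_nonneg G _ _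

lemma vol_nonneg (G : SimpleGraph V) : 0 ≤ vol G := Finset.sum_nonneg fun _ _ => wdeg_nonneg G _

open Classical in
lemma wdeg_eq_degree (G : SimpleGraph V) (i : V) : wdeg G i = G.degree i := by
  simp [wdeg, wt, ← SimpleGraph.card_neighborFinset_eq_degree, SimpleGraph.neighborFinset_eq_filter]

lemma one_le_wdeg_of_adj {G : SimpleGraph V} {i j : V} (h : G.Adj i j) : 1 ≤ wdeg G i := by
  classical
  have := Finset.single_le_sum (f := fun j => wt G i j) (fun _ _ => wt_nonneg G _ _)
    (Finset.mem_univ j)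
  rwa [wt, if_pos h] at this

open Classical in
lemma walkMatrix_coe (G : SimpleGraph V) (i j : V) :
    (walkMatrix G i j : ℝ) = wt G i j / wdeg G i := by
  rw [wdeg_eq_degree]
  simp only [walkMatrix, wt, Matrix.of_apply]
  split_ifs
  · push_cast; simp
  · simp

namespace IsResistance

variable {G : SimpleGraph V} {R : V → V → ℝ}

lemma nonneg (hR : IsResistance G R) (i j : V) : 0 ≤ R i j := by
  have := hR.triangle i j i
  rw [hR.self, hR.symm j i] at this
  linarith

lemma moment_nonneg (hR : IsResistance G R) (v : V) : 0 ≤ moment G R v :=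
  Finset.sum_nonneg fun _ _ => mul_nonneg (wdeg_nonneg G _) (hR.nonneg _ _)

lemma energy_nonneg (hR : IsResistance G R) : 0 ≤ energy G R :=
  Finset.sum_nonneg fun _ _ => mul_nonneg (wdeg_nonneg G _) (hR.moment_nonneg _)

/-- The mean first passage time in terms of resistances. -/
def passage (G : SimpleGraph V) (R : V → V → ℝ) (i j : V) : ℝ :=
  (vol G * R i j + moment G R j - moment G R i) / 2

/-- The numerator is a degree-weighted sum of `R i j + R k j - R k i`, so the triangle inequality
suffices. -/
lemma passage_nonneg (hR : IsResistance G R) (i j : V) : 0 ≤ passage G R i j := by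
  have : vol G * R i j + moment G R j - moment G R i
      = ∑ k, wdeg G k * (R i j + R k j - R k i) := by
    simp only [vol, moment, Finset.sum_mul, ← Finset.sum_add_distrib, ← Finset.sum_sub_distrib]
    exact Finset.sum_congr rfl fun _ _ => by ring
  rw [passage, this]
  refine div_nonneg (Finset.sum_nonneg fun k _ => mul_nonneg (wdeg_nonneg G _) ?_) (by norm_num)
  have := hR.triangle k j i
  rw [hR.symm j i] at this
  linarith

lemma passage_self (hR : IsResistance G R) (i : V) : passage G R i i = 0 := by
  simp [passage, hR.self]

-- The Laplacian identity summed over its columns with the degrees as weights.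
open Classical in
lemma sum_wt_moment {c : V → ℝ} (hR : IsResistance G R)
    (hc : ∀ i j, ∑ k, wt G i k * (R i j - R k j) = c i - if i = j then 2 else 0) (i : V) :
    ∑ k, wt G i k * (moment G R i - moment G R k) = vol G * c i - 2 * wdeg G i := by
  calc ∑ k, wt G i k * (moment G R i - moment G R k)
      = ∑ k, ∑ l, wdeg G l * (wt G i k * (R i l - R k l)) := by
        refine Finset.sum_congr rfl fun k _ => ?_
        simp only [moment, ← Finset.sum_sub_distrib, Finset.mul_sum]
        refine Finset.sum_congr rfl fun l _ => ?_
        rw [hR.symm l i, hR.symm l k]; ring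
    _ = ∑ l, wdeg G l * (c i - if i = l then 2 else 0) := by
        rw [Finset.sum_comm]
        simp only [← Finset.mul_sum, hc]
    _ = _ := by
        simp [mul_sub, Finset.sum_sub_distrib, vol, Finset.mul_sum, mul_comm]

/-- The Laplacian of `vol * R · j` and that of the moment both contain `vol * c i`; these cancel,
and the remaining `2 * wdeg G i` gives the first-step equation away from `j`. -/
lemma sum_wt_passage (hR : IsResistance G R) {i j : V} (hij : i ≠ j) :
    ∑ k, wt G i k * passage G R k j = wdeg G i * passage G R i j - wdeg G i := by
  classical
  obtain ⟨c, hc⟩ := hR.laplace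
  have h1 := sum_wt_moment hR hc i
  have h2 := hc i j
  rw [if_neg hij, sub_zero] at h2
  have h3 : wdeg G i * passage G R i j - ∑ k, wt G i k * passage G R k j
      = (vol G * ∑ k, wt G i k * (R i j - R k j)
        - ∑ k, wt G i k * (moment G R i - moment G R k)) / 2 := by
    rw [wdeg, Finset.sum_mul, Finset.mul_sum, ← Finset.sum_sub_distrib, ← Finset.sum_sub_distrib,
      Finset.sum_div]
    exact Finset.sum_congr rfl fun k _ => by rw [passage, passage]; ring
  rw [h1, h2] at h3
  linarith

lemma isStationary (hpos : ∀ i, 0 < wdeg G i) (hvol : 0 < vol G) :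
    IsStationary (walkMatrix G) fun i => (wdeg G i / vol G).toNNReal := by
  have hc : ∀ i, ((wdeg G i / vol G).toNNReal : ℝ) = wdeg G i / vol G := fun i =>
    Real.coe_toNNReal _ (div_nonneg (wdeg_nonneg G i) hvol.le)
  constructor
  · apply NNReal.coe_injective
    push_cast
    simp only [hc, ← Finset.sum_div]
    exact div_self hvol.ne'
  · intro j
    apply NNReal.coe_injective
    push_cast
    simp only [hc, walkMatrix_coe]
    rw [wdeg, Finset.sum_div]
    refine Finset.sum_congr rfl fun i _ => ?_
    have := (hpos i).ne'
    rw [wt_symm G j i]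
    field_simp

lemma meanFirstPassage_walkMatrix (hR : IsResistance G R) (hpos : ∀ i, 0 < wdeg G i) {i j : V}
    (hij : i ≠ j) :
    meanFirstPassage (walkMatrix G) i j = ((passage G R i j).toNNReal : ℝ≥0∞) := by
  classical
  have hp : ∀ i j, ((passage G R i j).toNNReal : ℝ) = passage G R i j := fun i j =>
    Real.coe_toNNReal _ (hR.passage_nonneg i j)
  -- First passage takes at least one step, so at `j` the solution must be the mean return time,
  -- whereas `passage` vanishes there. This `h` has the right value at `j` and equals `passage`
  -- elsewhere.
  set h : V → ℝ≥0 := fun i => 1 + ∑ k, walkMatrix G i k * (passage G R k j).toNNReal with hdef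
  have hne : ∀ i, i ≠ j → h i = (passage G R i j).toNNReal := by
    intro i hij
    apply NNReal.coe_injective
    simp only [hdef]
    push_cast
    simp only [hp, walkMatrix_coe, div_mul_eq_mul_div, ← Finset.sum_div, hR.sum_wt_passage hij]
    have := (hpos i).ne'
    field_simp
    ring
  rw [← hne i hij]
  refine meanFirstPassage_eq _ _ _ (fun i => ?_) i
  simp only [hdef]
  congr 1
  rw [← Finset.add_sum_erase _ _ (Finset.mem_univ j), hR.passage_self, Real.toNNReal_zero, mul_zero,
    zero_add]
  refine Finset.sum_congr rfl fun k hk => ?_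
  rw [← hne k (Finset.ne_of_mem_erase hk)]

/-- Kemeny's constant in terms of resistances. -/
theorem isKemenyConstant (hR : IsResistance G R) (hpos : ∀ i, 0 < wdeg G i) (hvol : 0 < vol G) :
    IsKemenyConstant (walkMatrix G) (energy G R / (2 * vol G)).toNNReal := by
  classical
  have hp : ∀ i j, ((passage G R i j).toNNReal : ℝ) = passage G R i j := fun i j =>
    Real.coe_toNNReal _ (hR.passage_nonneg i j)
  have hc : ∀ i, ((wdeg G i / vol G).toNNReal : ℝ) = wdeg G i / vol G := fun i =>
    Real.coe_toNNReal _ (div_nonneg (wdeg_nonneg G i) hvol.le)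
  refine ⟨_, isStationary hpos hvol, fun i => ?_⟩
  have h1 : ∀ j ∈ Finset.univ.erase i,
      meanFirstPassage (walkMatrix G) i j * ((wdeg G j / vol G).toNNReal : ℝ≥0∞)
        = (((passage G R i j).toNNReal * (wdeg G j / vol G).toNNReal : ℝ≥0) : ℝ≥0∞) := by
    intro j hj
    rw [hR.meanFirstPassage_walkMatrix hpos (Finset.ne_of_mem_erase hj).symm, ENNReal.coe_mul]
  -- The two terms in `moment G R i` cancel, whence the independence of `i`; the diagonal term is
  -- zero and may be included.
  have h2 : ∑ j, passage G R i j * (wdeg G j / vol G) = energy G R / (2 * vol G) := by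
    have e1 : ∑ j, wdeg G j * R i j = moment G R i :=
      Finset.sum_congr rfl fun j _ => by rw [hR.symm]
    have e2 : ∑ j, passage G R i j * (wdeg G j / vol G)
        = (vol G * ∑ j, wdeg G j * R i j + ∑ j, wdeg G j * moment G R j
            - (∑ j, wdeg G j) * moment G R i) / (2 * vol G) := by
      rw [Finset.mul_sum, Finset.sum_mul, ← Finset.sum_add_distrib, ← Finset.sum_sub_distrib,
        Finset.sum_div]
      refine Finset.sum_congr rfl fun j _ => ?_
      rw [passage]
      have := hvol.ne'
      field_simp
    rw [e2, e1, ← vol, ← energy]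
    ring_nf
  rw [Finset.sum_congr rfl h1, ← ENNReal.ofNNReal_finsetSum]
  congr 1
  apply NNReal.coe_injective
  rw [Real.coe_toNNReal _ (div_nonneg hR.energy_nonneg (by positivity)), ← h2,
    ← Finset.add_sum_erase _ _ (Finset.mem_univ i), hR.passage_self, zero_mul, zero_add]
  push_cast
  simp only [hp, hc]

end IsResistance

end Resistance

/-! ### Gluing two graphs at a cut vertex -/

section Glue

variable {V W : Type*}

/-- `Γ` is the union of `G` and `H`, with the vertex `v` of `G` and the vertex `none` of `H`
identified. -/
structure IsGluing (Γ : SimpleGraph (V ⊕ W)) (G : SimpleGraph V) (v : V)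
    (H : SimpleGraph (Option W)) : Prop where
  inl_inl : ∀ x y, Γ.Adj (.inl x) (.inl y) ↔ G.Adj x y
  inl_inr : ∀ x w, Γ.Adj (.inl x) (.inr w) ↔ x = v ∧ H.Adj none (some w)
  inr_inr : ∀ w w', Γ.Adj (.inr w) (.inr w') ↔ H.Adj (some w) (some w')

/-- The map that collapses the second part of a gluing. -/
def collapseRight (v : V) : V ⊕ W → V
  | .inl x => x
  | .inr _ => v

/-- The map that collapses the first part of a gluing. -/
def collapseLeft : V ⊕ W → Option W
  | .inl _ => none
  | .inr w => some w

/-- The resistances of a gluing. -/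
def glueResistance (R : V → V → ℝ) (v : V) (S : Option W → Option W → ℝ) (i j : V ⊕ W) : ℝ :=
  R (collapseRight v i) (collapseRight v j) + S (collapseLeft i) (collapseLeft j)

lemma wt_congr {V W : Type*} {G : SimpleGraph V} {H : SimpleGraph W} {i j : V} {k l : W}
    (h : G.Adj i j ↔ H.Adj k l) : wt G i j = wt H k l := by
  unfold wt
  split_ifs <;> tauto

lemma wt_self {V : Type*} (G : SimpleGraph V) (i : V) : wt G i i = 0 := by simp [wt]

namespace IsGluing

variable {Γ : SimpleGraph (V ⊕ W)} {G : SimpleGraph V} {v : V} {H : SimpleGraph (Option W)}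

lemma wt_inl_inl (h : IsGluing Γ G v H) (x y : V) : wt Γ (.inl x) (.inl y) = wt G x y :=
  wt_congr (h.inl_inl x y)

lemma wt_inr_inr (h : IsGluing Γ G v H) (w w' : W) :
    wt Γ (.inr w) (.inr w') = wt H (some w) (some w') :=
  wt_congr (h.inr_inr w w')

open Classical in
lemma wt_inl_inr (h : IsGluing Γ G v H) (x : V) (w : W) :
    wt Γ (.inl x) (.inr w) = if x = v then wt H none (some w) else 0 := by
  by_cases hx : x = v <;> simp [wt, h.inl_inr, hx]

open Classical in
lemma wt_inr_inl (h : IsGluing Γ G v H) (x : V) (w : W) :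
    wt Γ (.inr w) (.inl x) = if x = v then wt H (some w) none else 0 := by
  rw [wt_symm, h.wt_inl_inr, wt_symm H]

variable [Fintype V] [Fintype W]

open Classical in
lemma wdeg_inl (h : IsGluing Γ G v H) (x : V) :
    wdeg Γ (.inl x) = wdeg G x + if x = v then wdeg H none else 0 := by
  simp only [wdeg, Fintype.sum_sum_type, Fintype.sum_option, h.wt_inl_inl, h.wt_inl_inr, wt_self,
    zero_add]
  congr 1
  split_ifs <;> simp

lemma wdeg_inr (h : IsGluing Γ G v H) (w : W) : wdeg Γ (.inr w) = wdeg H (some w) := by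
  classical
  simp [wdeg, Fintype.sum_sum_type, Fintype.sum_option, h.wt_inr_inl, h.wt_inr_inr]

/-- Degree-weighted sums over a gluing. -/
lemma sum_wdeg_mul (h : IsGluing Γ G v H) (φ : V ⊕ W → ℝ) :
    ∑ i, wdeg Γ i * φ i
      = ∑ x, wdeg G x * φ (.inl x)
        + ∑ w, wdeg H w * (w.elim (φ (.inl v)) fun w => φ (.inr w)) := by
  classical
  simp only [Fintype.sum_sum_type, Fintype.sum_option, h.wdeg_inl, h.wdeg_inr, add_mul, ite_mul,
    zero_mul, Finset.sum_add_distrib, Finset.sum_ite_eq', Finset.mem_univ,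
    if_true, Option.elim]
  ring

lemma vol_eq (h : IsGluing Γ G v H) : vol Γ = vol G + vol H := by
  have := h.sum_wdeg_mul fun _ => 1
  simp only [mul_one] at this
  rw [vol, this, vol, vol]
  congr 1
  refine Finset.sum_congr rfl fun w _ => ?_
  cases w <;> simp

variable {R : V → V → ℝ} {S : Option W → Option W → ℝ}

lemma wdeg_pos (h : IsGluing Γ G v H) (hG : ∀ x, 0 < wdeg G x) (hH : ∀ w, 0 < wdeg H w)
    (i : V ⊕ W) : 0 < wdeg Γ i := by
  classical
  rcases i with x | w
  · rw [h.wdeg_inl]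
    have := hG x
    have := hH none
    split_ifs <;> linarith
  · rw [h.wdeg_inr]; exact hH _

lemma isResistance (h : IsGluing Γ G v H) (hR : IsResistance G R) (hS : IsResistance H S) :
    IsResistance Γ (glueResistance R v S) where
  symm i j := by simp only [glueResistance]; rw [hR.symm, hS.symm]
  self i := by simp [glueResistance, hR.self, hS.self]
  triangle i j k := by
    have h1 := hR.triangle (collapseRight v i) (collapseRight v j) (collapseRight v k)
    have h2 := hS.triangle (collapseLeft i) (collapseLeft j) (collapseLeft k)
    simp only [glueResistance]
    linarith
  laplace := by
    classical
    obtain ⟨c, hc⟩ := hR.laplace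
    obtain ⟨d, hd⟩ := hS.laplace
    -- In the row of `v` both Laplacians act. Any column collapses to the gluing vertex in at least
    -- one piece, which costs one 2 that is absorbed in the constant; only column `v` collapses so
    -- in both and keeps a further 2.
    refine ⟨Sum.elim (fun x => c x + if x = v then d none - 2 else 0) fun w => d (some w), ?_⟩
    rintro (x | w) j
    · rw [show ∑ k, wt Γ (.inl x) k * (glueResistance R v S (.inl x) j - glueResistance R v S k j)
        = ∑ y, wt G x y * (R x (collapseRight v j) - R y (collapseRight v j))
          + if x = v then ∑ y, wt H none y * (S none (collapseLeft j) - S y (collapseLeft j))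
            else 0 from ?_]
      · rw [hc, hd]
        rcases j with y | w
        · rcases eq_or_ne x y with rfl | hy
          · rcases eq_or_ne x v with rfl | hx
            · simp [collapseRight, collapseLeft]; ring
            · simp [collapseRight, hx]
          · rcases eq_or_ne x v with rfl | hx
            · simp [collapseRight, collapseLeft, hy]
            · simp [collapseRight, hx, hy]
        · rcases eq_or_ne x v with rfl | hx
          · simp [collapseRight, collapseLeft]; ring
          · simp [collapseRight, hx]
      · simp only [Fintype.sum_sum_type, Fintype.sum_option, h.wt_inl_inl, h.wt_inl_inr,
          glueResistance, collapseRight, collapseLeft, sub_self, mul_zero, zero_add]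
        congr 1
        · exact Finset.sum_congr rfl fun y _ => by ring
        · split_ifs with hx
          · subst hx
            exact Finset.sum_congr rfl fun y _ => by ring
          · simp
    · have := hd (some w) (collapseLeft j)
      rw [Fintype.sum_option] at this
      simp only [Fintype.sum_sum_type, h.wt_inr_inl, h.wt_inr_inr, glueResistance, collapseRight,
        collapseLeft, ite_mul, zero_mul, Finset.sum_ite_eq', Finset.mem_univ,
        if_true, add_sub_add_left_eq_sub, Sum.elim_inr]
      refine this.trans ?_
      rcases j with y | w'
      · simp [collapseLeft]
      · by_cases hw : w = w' <;> simp [collapseLeft, hw]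

lemma moment_inl (h : IsGluing Γ G v H) (hS : IsResistance H S) (x : V) :
    moment Γ (glueResistance R v S) (.inl x) = moment G R x + vol H * R v x + moment H S none := by
  rw [moment, h.sum_wdeg_mul, moment, moment, vol, Finset.sum_mul, add_assoc,
    ← Finset.sum_add_distrib]
  congr 1
  · exact Finset.sum_congr rfl fun y _ => by simp [glueResistance, collapseRight, collapseLeft, hS.self]
  · refine Finset.sum_congr rfl fun w _ => ?_
    cases w <;> simp [glueResistance, collapseRight, collapseLeft, hS.self, mul_add]

lemma moment_inr (h : IsGluing Γ G v H) (hR : IsResistance G R) (w : W) :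
    moment Γ (glueResistance R v S) (.inr w)
      = moment G R v + vol G * S none (some w) + moment H S (some w) := by
  rw [moment, h.sum_wdeg_mul, moment, moment, vol, Finset.sum_mul, ← Finset.sum_add_distrib]
  congr 1
  · exact Finset.sum_congr rfl fun y _ => by
      simp [glueResistance, collapseRight, collapseLeft, mul_add]
  · refine Finset.sum_congr rfl fun w _ => ?_
    cases w <;> simp [glueResistance, collapseRight, collapseLeft, hR.self]

lemma moment_def {V : Type*} [Fintype V] (G : SimpleGraph V) (R : V → V → ℝ) (v : V) :
    moment G R v = ∑ i, wdeg G i * R i v := rfl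

/-- A pair with one vertex in each piece has its resistance split at `v`; summing over the other
piece turns each part into a volume times a moment. -/
lemma energy_eq (h : IsGluing Γ G v H) (hR : IsResistance G R) (hS : IsResistance H S) :
    energy Γ (glueResistance R v S) = energy G R + energy H S + 2 * vol H * moment G R v
      + 2 * vol G * moment H S none := by
  rw [energy, h.sum_wdeg_mul]
  have h1 : ∑ x, wdeg G x * moment Γ (glueResistance R v S) (.inl x)
      = energy G R + vol H * moment G R v + vol G * moment H S none := by
    rw [energy, vol, vol, moment, Finset.mul_sum, Finset.sum_mul, ← Finset.sum_add_distrib,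
      ← Finset.sum_add_distrib]
    refine Finset.sum_congr rfl fun x _ => ?_
    rw [h.moment_inl hS, hR.symm v x, vol]; ring
  have h2 : ∑ w, wdeg H w * (w.elim (moment Γ (glueResistance R v S) (.inl v))
        fun w => moment Γ (glueResistance R v S) (.inr w))
      = energy H S + vol G * moment H S none + vol H * moment G R v := by
    rw [energy, vol, vol, moment_def H, Finset.mul_sum, Finset.sum_mul, ← Finset.sum_add_distrib,
      ← Finset.sum_add_distrib]
    refine Finset.sum_congr rfl fun w _ => ?_
    cases w with
    | none => simp [h.moment_inl hS, hR.self, hS.self]; ring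
    | some w => simp [h.moment_inr hR, hS.symm none, vol]; ring
  rw [h1, h2]; ring

end IsGluing

end Glue

/-! ### Resistances of paths and cycles -/

section Paths

/-- The path with `n + 1` vertices together with the edge between its ends. -/
def closedPath (n : ℕ) : SimpleGraph (Fin (n + 1)) :=
  SimpleGraph.pathGraph (n + 1) ⊔ SimpleGraph.edge 0 (Fin.last n)

/-- The resistances of the path. -/
def pathResistance (n : ℕ) (i j : Fin (n + 1)) : ℝ := |(i : ℝ) - j|

/-- The resistances of the cycle. -/
def cycleResistance (n : ℕ) (i j : Fin (n + 1)) : ℝ :=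
  |(i : ℝ) - j| - ((n : ℝ) + 1)⁻¹ * ((i : ℝ) - j) ^ 2

lemma sum_fin_ite (n c : ℕ) (g : ℝ → ℝ) :
    ∑ k : Fin (n + 1), (if (k : ℕ) = c then g k else 0) = if c ≤ n then g c else 0 := by
  rw [Fin.sum_univ_eq_sum_range (fun k : ℕ => if k = c then g k else 0) (n + 1)]
  simp

/-- Taking `g` on the reals lets the neighbours `i + 1` and `i - 1` be written without bounds
proofs. -/
lemma sum_wt_pathGraph (n : ℕ) (i : Fin (n + 1)) (g : ℝ → ℝ) :
    ∑ k, wt (SimpleGraph.pathGraph (n + 1)) i k * g k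
      = (if (i : ℕ) + 1 ≤ n then g (i + 1) else 0) + if (i : ℕ) = 0 then 0 else g (i - 1) := by
  have h : ∀ k : Fin (n + 1), wt (SimpleGraph.pathGraph (n + 1)) i k * g k
      = (if (k : ℕ) = i + 1 then g k else 0) + if (k : ℕ) + 1 = i then g k else 0 := by
    intro k
    simp only [wt, SimpleGraph.pathGraph_adj]
    split_ifs <;> first | omega | simp
  simp only [h, Finset.sum_add_distrib, sum_fin_ite]
  congr 1
  · push_cast; rfl
  · obtain ⟨i, hi⟩ := i
    cases i with
    | zero => simp
    | succ i =>
      have := sum_fin_ite n i g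
      rw [if_pos (by omega)] at this
      simpa using this

/-- For `n = 1` the closing edge is already in the path, and for `n = 0` it would be a loop. -/
lemma wt_closedPath {n : ℕ} (hn : 2 ≤ n) (i k : Fin (n + 1)) :
    wt (closedPath n) i k = wt (SimpleGraph.pathGraph (n + 1)) i k
      + ((if (k : ℕ) = n then if (i : ℕ) = 0 then 1 else 0 else 0)
        + if (k : ℕ) = 0 then if (i : ℕ) = n then 1 else 0 else 0) := by
  simp only [wt, closedPath, SimpleGraph.sup_adj, SimpleGraph.pathGraph_adj, SimpleGraph.edge_adj,
    Fin.ext_iff, Fin.val_last, Fin.val_zero]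
  split_ifs <;> first | omega | simp

lemma sum_wt_closedPath {n : ℕ} (hn : 2 ≤ n) (i : Fin (n + 1)) (g : ℝ → ℝ) :
    ∑ k, wt (closedPath n) i k * g k
      = ∑ k, wt (SimpleGraph.pathGraph (n + 1)) i k * g k
        + ((if (i : ℕ) = 0 then g n else 0) + if (i : ℕ) = n then g 0 else 0) := by
  have h1 := sum_fin_ite n n fun x => (if (i : ℕ) = 0 then 1 else 0) * g x
  have h2 := sum_fin_ite n 0 fun x => (if (i : ℕ) = n then 1 else 0) * g x
  simp only [wt_closedPath hn, add_mul, Finset.sum_add_distrib]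
  congr 1
  simp only [ite_mul, zero_mul, one_mul, le_refl, zero_le, if_true, Nat.cast_zero] at h1 h2 ⊢
  rw [h1, h2]

lemma vol_closedPath {n : ℕ} (hn : 2 ≤ n) :
    vol (closedPath n) = vol (SimpleGraph.pathGraph (n + 1)) + 2 := by
  have h : ∀ i, wdeg (closedPath n) i = wdeg (SimpleGraph.pathGraph (n + 1)) i
      + ((if (i : ℕ) = 0 then 1 else 0) + if (i : ℕ) = n then 1 else 0) := fun i => by
    simpa [wdeg] using sum_wt_closedPath hn i fun _ => 1
  have h1 := sum_fin_ite n 0 fun _ => 1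
  have h2 := sum_fin_ite n n fun _ => 1
  simp only [vol, h, Finset.sum_add_distrib, h1, h2]
  norm_num

lemma wdeg_pathGraph_pos {n : ℕ} (hn : 1 ≤ n) (i : Fin (n + 1)) :
    0 < wdeg (SimpleGraph.pathGraph (n + 1)) i := by
  obtain ⟨j, hj⟩ : ∃ j, (SimpleGraph.pathGraph (n + 1)).Adj i j := by
    simp only [SimpleGraph.pathGraph_adj]
    rcases Nat.eq_zero_or_pos i with h | h
    · exact ⟨⟨1, by omega⟩, by simp [h]⟩
    · exact ⟨⟨i - 1, by omega⟩, by simp only; omega⟩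
  linarith [one_le_wdeg_of_adj hj]

lemma wdeg_closedPath_pos {n : ℕ} (hn : 2 ≤ n) (i : Fin (n + 1)) :
    0 < wdeg (closedPath n) i := by
  have := sum_wt_closedPath hn i fun _ => 1
  simp only [mul_one] at this
  have h := wdeg_pathGraph_pos (by omega : 1 ≤ n) i
  rw [wdeg] at h ⊢
  rw [this]
  split_ifs <;> linarith

lemma isResistance_pathGraph (n : ℕ) :
    IsResistance (SimpleGraph.pathGraph (n + 1)) (pathResistance n) where
  symm i j := abs_sub_comm _ _
  self i := by simp [pathResistance]
  triangle i j k := abs_sub_le _ _ _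
  laplace := by
    refine ⟨fun i => 2 - ((if (i : ℕ) + 1 ≤ n then 1 else 0) + if (i : ℕ) = 0 then 0 else 1),
      fun i j => ?_⟩
    have := sum_wt_pathGraph n i fun x => |(i : ℝ) - j| - |x - j|
    simp only [pathResistance]
    rw [this]
    rcases lt_trichotomy (i : ℕ) j with h | h | h
    · have h' : (i : ℝ) + 1 ≤ j := by exact_mod_cast h
      have hne : i ≠ j := fun e => by simp [e] at h
      rw [if_neg hne, abs_of_nonpos (by linarith : (i : ℝ) - j ≤ 0),
        abs_of_nonpos (by linarith : (i : ℝ) + 1 - j ≤ 0),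
        abs_of_nonpos (by linarith : (i : ℝ) - 1 - j ≤ 0), if_pos (by omega : (i : ℕ) + 1 ≤ n),
        if_pos (by omega : (i : ℕ) + 1 ≤ n)]
      split_ifs <;> ring
    · obtain rfl : i = j := Fin.ext h
      simp only [sub_self, abs_zero, add_sub_cancel_left, sub_sub_cancel_left, if_true, abs_neg,
        abs_one]
      split_ifs <;> ring
    · have h' : (j : ℝ) + 1 ≤ i := by exact_mod_cast h
      have hne : i ≠ j := fun e => by simp [e] at h
      rw [if_neg hne, abs_of_nonneg (by linarith : 0 ≤ (i : ℝ) - j),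
        abs_of_nonneg (by linarith : 0 ≤ (i : ℝ) + 1 - j),
        abs_of_nonneg (by linarith : 0 ≤ (i : ℝ) - 1 - j), if_neg (by omega : ¬ (i : ℕ) = 0),
        if_neg (by omega : ¬ (i : ℕ) = 0)]
      split_ifs <;> ring

/-- The defect is `|x| + |y| - |x + y| + 2 * a * x * y`. For equal signs it is `2 * a * x * y`; for
opposite signs it is twice the smaller of `|x|`, `|y|` times one minus `a` times the larger. -/
lemma cycle_triangle {a x y : ℝ} (ha : 0 ≤ a) (hx : a * |x| ≤ 1) (hy : a * |y| ≤ 1) :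
    |x + y| - a * (x + y) ^ 2 ≤ (|x| - a * x ^ 2) + (|y| - a * y ^ 2) := by
  have h1 : 0 ≤ (1 - a * |x|) * |y| := mul_nonneg (by linarith) (abs_nonneg y)
  have h2 : 0 ≤ (1 - a * |y|) * |x| := mul_nonneg (by linarith) (abs_nonneg x)
  have h3 : 0 ≤ a * (|x| * |y| + x * y) := mul_nonneg ha (by
    have := neg_abs_le (x * y)
    rw [abs_mul] at this
    linarith)
  rcases le_total 0 x with hx0 | hx0 <;> rcases le_total 0 y with hy0 | hy0 <;>
    rcases le_total 0 (x + y) with hxy | hxy <;>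
    simp only [abs_of_nonneg, abs_of_nonpos, hx0, hy0, hxy] at h1 h2 h3 ⊢ <;>
    nlinarith

lemma isResistance_closedPath {n : ℕ} (hn : 2 ≤ n) :
    IsResistance (closedPath n) (cycleResistance n) where
  symm i j := by simp only [cycleResistance]; rw [abs_sub_comm]; ring
  self i := by simp [cycleResistance]
  triangle i j k := by
    have hb : ∀ i j : Fin (n + 1), ((n : ℝ) + 1)⁻¹ * |(i : ℝ) - j| ≤ 1 := fun i j => by
      rw [inv_mul_le_one₀ (by positivity), abs_le]
      have hi : ((i : ℕ) : ℝ) ≤ n := by exact_mod_cast Nat.lt_succ_iff.mp i.2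
      have hj : ((j : ℕ) : ℝ) ≤ n := by exact_mod_cast Nat.lt_succ_iff.mp j.2
      have hi0 : (0 : ℝ) ≤ (i : ℕ) := by positivity
      have hj0 : (0 : ℝ) ≤ (j : ℕ) := by positivity
      constructor <;> linarith
    have := cycle_triangle (by positivity) (hb i j) (hb j k)
    simpa [cycleResistance] using this
  laplace := by
    have hn0 : (n : ℝ) + 1 ≠ 0 := by positivity
    refine ⟨fun i => 2 * ((n : ℝ) + 1)⁻¹, fun i j => ?_⟩
    have e := sum_wt_closedPath hn i fun x =>
      (|(i : ℝ) - j| - ((n : ℝ) + 1)⁻¹ * ((i : ℝ) - j) ^ 2)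
        - (|x - j| - ((n : ℝ) + 1)⁻¹ * (x - j) ^ 2)
    rw [sum_wt_pathGraph n i fun x =>
      (|(i : ℝ) - j| - ((n : ℝ) + 1)⁻¹ * ((i : ℝ) - j) ^ 2)
        - (|x - j| - ((n : ℝ) + 1)⁻¹ * (x - j) ^ 2)] at e
    simp only [cycleResistance]
    rw [e]
    have ha : ((n : ℝ) + 1)⁻¹ * (n + 1) = 1 := inv_mul_cancel₀ hn0
    generalize ((n : ℝ) + 1)⁻¹ = a at ha
    have hj0 : (0 : ℝ) ≤ (j : ℕ) := by positivity
    have hjn : ((j : ℕ) : ℝ) ≤ n := by exact_mod_cast Nat.lt_succ_iff.mp j.2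
    have hin := i.2
    have hji : (i : ℕ) = j ↔ i = j := Fin.ext_iff.symm
    rw [abs_of_nonpos (by linarith : (0 : ℝ) - j ≤ 0), abs_of_nonneg (by linarith : 0 ≤ (n : ℝ) - j)]
    rcases lt_trichotomy (i : ℕ) j with h | h | h
    · have h' : (i : ℝ) + 1 ≤ j := by exact_mod_cast h
      have hne : i ≠ j := fun e => by simp [e] at h
      rw [if_neg hne, abs_of_nonpos (by linarith : (i : ℝ) - j ≤ 0),
        abs_of_nonpos (by linarith : (i : ℝ) + 1 - j ≤ 0),
        abs_of_nonpos (by linarith : (i : ℝ) - 1 - j ≤ 0), if_pos (by omega : (i : ℕ) + 1 ≤ n)]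
      by_cases hi : (i : ℕ) = 0
      · rw [if_pos hi, if_pos hi, if_neg (by omega : ¬ (i : ℕ) = n), hi]
        push_cast
        linear_combination (n - 1 - 2 * (j : ℝ)) * ha
      · rw [if_neg hi, if_neg hi, if_neg (by omega : ¬ (i : ℕ) = n)]
        ring
    · obtain rfl : i = j := Fin.ext h
      simp only [sub_self, abs_zero, add_sub_cancel_left, sub_sub_cancel_left, if_true, abs_neg,
        abs_one]
      by_cases hi : (i : ℕ) = 0
      · rw [if_pos hi, if_pos hi, if_neg (by omega : ¬ (i : ℕ) = n),
          if_pos (by omega : (i : ℕ) + 1 ≤ n), hi]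
        push_cast
        linear_combination (n - 1 : ℝ) * ha
      · by_cases hi' : (i : ℕ) = n
        · rw [if_neg hi, if_neg hi, if_pos hi', if_neg (by omega : ¬ (i : ℕ) + 1 ≤ n), hi']
          linear_combination (n - 1 : ℝ) * ha
        · rw [if_neg hi, if_neg hi, if_neg hi', if_pos (by omega : (i : ℕ) + 1 ≤ n)]
          ring
    · have h' : (j : ℝ) + 1 ≤ i := by exact_mod_cast h
      have hne : i ≠ j := fun e => by simp [e] at h
      rw [if_neg hne, abs_of_nonneg (by linarith : 0 ≤ (i : ℝ) - j),
        abs_of_nonneg (by linarith : 0 ≤ (i : ℝ) + 1 - j),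
        abs_of_nonneg (by linarith : 0 ≤ (i : ℝ) - 1 - j), if_neg (by omega : ¬ (i : ℕ) = 0),
        if_neg (by omega : ¬ (i : ℕ) = 0)]
      by_cases hi' : (i : ℕ) = n
      · rw [if_pos hi', if_neg (by omega : ¬ (i : ℕ) + 1 ≤ n), hi']
        linear_combination (2 * (j : ℝ) - n - 1) * ha
      · rw [if_neg hi', if_pos (by omega : (i : ℕ) + 1 ≤ n)]
        ring

end Paths

/-! ### Relabelling vertices -/

section Transport

variable {V W : Type*} (e : W ≃ V) (G : SimpleGraph V)

lemma wt_comap (x y : W) : wt (G.comap e) x y = wt G (e x) (e y) := wt_congr Iff.rfl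

variable [Fintype V] [Fintype W]

lemma wdeg_comap (x : W) : wdeg (G.comap e) x = wdeg G (e x) := by
  simp only [wdeg, wt_comap]
  exact e.sum_comp (wt G (e x))

lemma vol_comap : vol (G.comap e) = vol G := by
  simp only [vol, wdeg_comap]
  exact e.sum_comp (wdeg G)

lemma IsResistance.comap {G : SimpleGraph V} {R : V → V → ℝ} (hR : IsResistance G R) :
    IsResistance (G.comap e) fun x y => R (e x) (e y) where
  symm _ _ := hR.symm _ _
  self _ := hR.self _
  triangle _ _ _ := hR.triangle _ _ _
  laplace := by
    obtain ⟨c, hc⟩ := hR.laplace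
    refine ⟨fun x => c (e x), fun x y => ?_⟩
    simp only [wt_comap]
    rw [e.sum_comp fun k => wt G (e x) k * (R (e x) (e y) - R k (e y)), hc]
    by_cases h : x = y <;> simp [h]

end Transport

/-! ### Twin pendent paths as gluings -/

section Twin

variable {V : Type*}

/-- The position of a vertex along the path obtained by joining the twin paths. -/
def twinPosition (k₁ k₂ : ℕ) : Option (Fin k₁ ⊕ Fin k₂) → Fin (k₁ + k₂ + 1)
  | none => ⟨k₂, by omega⟩
  | some (.inl i) => ⟨k₂ + 1 + i, by omega⟩
  | some (.inr j) => ⟨k₂ - 1 - j, by omega⟩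

lemma twinPosition_bijective (k₁ k₂ : ℕ) : Function.Bijective (twinPosition k₁ k₂) := by
  rw [Fintype.bijective_iff_injective_and_card]
  refine ⟨?_, by simp⟩
  rintro (_ | i | i) (_ | j | j) h <;> simp only [twinPosition, Fin.ext_iff] at h <;>
    first
      | rfl
      | omega
      | (congr 2; exact Fin.ext (by omega))

/-- The bijection given by `twinPosition`. -/
def twinEquiv (k₁ k₂ : ℕ) : Option (Fin k₁ ⊕ Fin k₂) ≃ Fin (k₁ + k₂ + 1) :=
  Equiv.ofBijective _ (twinPosition_bijective k₁ k₂)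

lemma isGluing_twinPaths (G : SimpleGraph V) (v : V) (k₁ k₂ : ℕ) :
    IsGluing (twinPaths G v k₁ k₂) G v
      ((SimpleGraph.pathGraph (k₁ + k₂ + 1)).comap (twinEquiv k₁ k₂)) where
  inl_inl x y := by
    simp only [twinPaths, SimpleGraph.fromRel_adj, twinRel, G.adj_comm y x, or_self, ne_eq,
      Sum.inl.injEq]
    exact ⟨fun h => h.2, fun h => ⟨h.ne, h⟩⟩
  inl_inr x w := by
    rcases w with i | j
    · simp [twinPaths, twinRel, twinEquiv, twinPosition, SimpleGraph.pathGraph_adj]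
      intro _; omega
    · simp [twinPaths, twinRel, twinEquiv, twinPosition, SimpleGraph.pathGraph_adj]
      intro _; omega
  inr_inr w w' := by
    rcases w with i | j <;> rcases w' with i' | j' <;>
      simp [twinPaths, twinRel, twinEquiv, twinPosition, SimpleGraph.pathGraph_adj, Fin.ext_iff] <;>
      omega

/-- The second path is laid out backwards before `v` and the first one after it, so the two ends are
positions `k₁ + k₂` and `0`, even when one of them is `v` itself. -/
lemma isGluing_twinPathsClosed (G : SimpleGraph V) (v : V) {k₁ k₂ : ℕ} (hk : 2 ≤ k₁ + k₂) :
    IsGluing (twinPathsClosed G v k₁ k₂) G v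
      ((closedPath (k₁ + k₂)).comap (twinEquiv k₁ k₂)) where
  inl_inl x y := by
    rw [twinPathsClosed, SimpleGraph.sup_adj, (isGluing_twinPaths G v k₁ k₂).inl_inl]
    rcases k₁ with _ | k₁ <;> rcases k₂ with _ | k₂ <;>
      simp [firstEnd, secondEnd, SimpleGraph.edge_adj] at hk ⊢
  inl_inr x w := by
    rw [twinPathsClosed, SimpleGraph.sup_adj, (isGluing_twinPaths G v k₁ k₂).inl_inr]
    simp only [closedPath, SimpleGraph.comap_adj, SimpleGraph.sup_adj, and_or_left]
    refine or_congr Iff.rfl ?_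
    rcases k₁ with _ | k₁ <;> rcases k₂ with _ | k₂ <;> rcases w with i | j <;>
      simp only [firstEnd, secondEnd, SimpleGraph.edge_adj, twinEquiv, Equiv.ofBijective_apply,
        twinPosition, Fin.ext_iff, Fin.val_last, Fin.val_zero, Sum.inl.injEq, Sum.inr.injEq,
        reduceCtorEq, ne_eq] <;>
      grind
  inr_inr w w' := by
    rw [twinPathsClosed, SimpleGraph.sup_adj, (isGluing_twinPaths G v k₁ k₂).inr_inr]
    simp only [closedPath, SimpleGraph.comap_adj, SimpleGraph.sup_adj]
    refine or_congr Iff.rfl ?_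
    rcases k₁ with _ | k₁ <;> rcases k₂ with _ | k₂ <;> rcases w with i | j <;>
      rcases w' with i' | j'
    all_goals first | exact Fin.elim0 ‹_› | skip
    all_goals
      simp only [firstEnd, secondEnd, SimpleGraph.edge_adj, twinEquiv, Equiv.ofBijective_apply,
        twinPosition, Fin.ext_iff, Fin.val_last, Fin.val_zero, Sum.inl.injEq, Sum.inr.injEq,
        reduceCtorEq, ne_eq]
      grind

end Twin

/-! ### Distances in trees are resistances -/

section Tree

variable {V : Type*}

/-- The distance in a graph, as a real number. -/
def rdist (G : SimpleGraph V) (i j : V) : ℝ := G.dist i j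

lemma exists_adj_dist {G : SimpleGraph V} (hG : G.Connected) {i j : V} (h : i ≠ j) :
    ∃ k, G.Adj i k ∧ G.dist i j = G.dist k j + 1 := by
  obtain ⟨p, hp⟩ := hG.exists_walk_length_eq_dist i j
  cases p with
  | nil => exact absurd rfl h
  | cons hadj q =>
    refine ⟨_, hadj, ?_⟩
    have h1 := SimpleGraph.dist_le q
    have h2 := hG.dist_triangle (u := i) (v := _) (w := j) |>.trans
      (Nat.add_le_add_right (SimpleGraph.dist_eq_one_iff_adj.mpr hadj).le _)
    rw [SimpleGraph.Walk.length_cons] at hp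
    omega

/-- Each such neighbour starts a geodesic to `j`, and a tree has only one path from `i` to `j`. -/
lemma adj_dist_unique {G : SimpleGraph V} (hG : G.IsTree) {i j k l : V} (hk : G.Adj i k)
    (hl : G.Adj i l) (hk' : G.dist i j = G.dist k j + 1) (hl' : G.dist i j = G.dist l j + 1) :
    k = l := by
  obtain ⟨p, hp⟩ := hG.connected.exists_walk_length_eq_dist k j
  obtain ⟨q, hq⟩ := hG.connected.exists_walk_length_eq_dist l j
  have hp' : (SimpleGraph.Walk.cons hk p).IsPath :=
    SimpleGraph.Walk.isPath_of_length_eq_dist _ (by rw [SimpleGraph.Walk.length_cons, hp, hk'])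
  have hq' : (SimpleGraph.Walk.cons hl q).IsPath :=
    SimpleGraph.Walk.isPath_of_length_eq_dist _ (by rw [SimpleGraph.Walk.length_cons, hq, hl'])
  have e := (hG.existsUnique_path i j).unique hp' hq'
  simpa using congrArg SimpleGraph.Walk.snd e

variable [Fintype V]

/-- In a tree the distances are the effective resistances. -/
lemma isResistance_rdist {G : SimpleGraph V} (hG : G.IsTree) : IsResistance G (rdist G) where
  symm i j := by rw [rdist, rdist, SimpleGraph.dist_comm]
  self i := by simp [rdist]
  triangle i j k := by unfold rdist; exact_mod_cast hG.connected.dist_triangle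
  laplace := by
    classical
    -- If `i ≠ j`, one neighbour of `i` is nearer to `j` and the others are farther: `1 - (wdeg G i
    -- - 1)`. If `i = j`, all are farther.
    refine ⟨fun i => 2 - wdeg G i, fun i j => ?_⟩
    have hne : ∀ k, G.Adj i k → G.dist i j ≠ G.dist k j + 1 → G.dist k j = G.dist i j + 1 := by
      intro k hk h
      have := hG.dist_eq_dist_add_one_of_adj j hk
      rw [SimpleGraph.dist_comm (u := j), SimpleGraph.dist_comm (u := j)] at this
      tauto
    by_cases hij : i = j
    · subst hij
      rw [if_pos rfl, show 2 - wdeg G i - 2 = - wdeg G i by ring, wdeg, ← Finset.sum_neg_distrib]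
      refine Finset.sum_congr rfl fun k _ => ?_
      by_cases hk : G.Adj i k
      · have := hne k hk (by simp)
        simp [wt, hk, rdist, this]
      · simp [wt, hk]
    · rw [if_neg hij]
      obtain ⟨k₀, hk₀, hd⟩ := exists_adj_dist hG.connected hij
      have : ∀ k, wt G i k * (rdist G i j - rdist G k j)
          = (if k = k₀ then 2 else 0) - wt G i k := by
        intro k
        by_cases hk : G.Adj i k
        · by_cases h : k = k₀
          · subst h
            simp only [wt, hk, if_true, rdist, hd]
            push_cast; ring
          · have := hne k hk fun h' => h (adj_dist_unique hG hk hk₀ h' hd)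
            simp [wt, hk, rdist, this, h]
        · have : k ≠ k₀ := fun h => hk (h ▸ hk₀)
          simp [wt, hk, this]
      simp only [this, Finset.sum_sub_distrib, Finset.sum_ite_eq', Finset.mem_univ, if_true, wdeg,
        sub_zero]

lemma vol_eq_two_mul_card_edgeSet (G : SimpleGraph V) : vol G = 2 * (Nat.card G.edgeSet : ℝ) := by
  classical
  have := G.sum_degrees_eq_twice_card_edges
  simp only [vol, wdeg_eq_degree]
  rw [Nat.card_eq_fintype_card, ← SimpleGraph.edgeFinset_card]
  exact_mod_cast this

/-- By the handshake lemma the edge count can be tracked through `vol`, which grows by 2 in either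
growth step. -/
lemma isTree_iff_vol (G : SimpleGraph V) :
    G.IsTree ↔ G.Connected ∧ vol G + 2 = 2 * (Fintype.card V : ℝ) := by
  rw [SimpleGraph.isTree_iff_connected_and_card, vol_eq_two_mul_card_edgeSet,
    Nat.card_eq_fintype_card (α := V)]
  refine and_congr_right fun _ => ?_
  rw [← Nat.cast_inj (R := ℝ)]
  push_cast
  constructor <;> intro h <;> linarith

end Tree

/-! ### Growth steps preserve trees -/

section Growth

variable {V : Type*}

lemma map_some_adj (G : SimpleGraph V) (x y : V) :
    (SimpleGraph.map some G).Adj (some x) (some y) ↔ G.Adj x y :=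
  SimpleGraph.map_adj_apply (f := Function.Embedding.some)

lemma not_map_some_adj_none (G : SimpleGraph V) (y : Option V) :
    ¬ (SimpleGraph.map some G).Adj none y := by
  simp [SimpleGraph.map_adj']

lemma connected_addPendent {G : SimpleGraph V} (hG : G.Connected) (u : V) :
    (addPendent G u).Connected := by
  have hsome : ∀ x y, (addPendent G u).Reachable (some x) (some y) := fun x y =>
    ((hG x y).map (SimpleGraph.Hom.ofLE (le_refl G))).map
      (⟨some, fun h => Or.inl (by simpa [map_some_adj] using h)⟩ : G →g addPendent G u)
  have hnone : (addPendent G u).Reachable none (some u) :=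
    SimpleGraph.Adj.reachable (Or.inr (by simp [SimpleGraph.edge_adj]))
  rw [SimpleGraph.connected_iff_exists_forall_reachable]
  refine ⟨some u, ?_⟩
  rintro (_ | x)
  exacts [hnone.symm, hsome u x]

lemma connected_subdivideEdge {G : SimpleGraph V} (hG : G.Connected) {a b : V} (hab : G.Adj a b) :
    (subdivideEdge G a b).Connected := by
  have ha : (subdivideEdge G a b).Reachable none (some a) :=
    SimpleGraph.Adj.reachable (Or.inl (Or.inr (by simp [SimpleGraph.edge_adj])))
  have hb : (subdivideEdge G a b).Reachable none (some b) :=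
    SimpleGraph.Adj.reachable (Or.inr (by simp [SimpleGraph.edge_adj]))
  have hadj : ∀ x y, G.Adj x y → (subdivideEdge G a b).Reachable (some x) (some y) := by
    intro x y h
    -- The deleted edge is bypassed through the new vertex.
    by_cases he : s(x, y) = s(a, b)
    · rw [Sym2.eq_iff] at he
      rcases he with ⟨rfl, rfl⟩ | ⟨rfl, rfl⟩
      exacts [ha.symm.trans hb, hb.symm.trans ha]
    · exact SimpleGraph.Adj.reachable (Or.inl (Or.inl (by
        simpa [map_some_adj, SimpleGraph.deleteEdges_adj, h] using he)))
  have hsome : ∀ x y, (subdivideEdge G a b).Reachable (some x) (some y) := by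
    intro x y
    obtain ⟨p⟩ := hG x y
    induction p with
    | nil => exact SimpleGraph.Reachable.refl _
    | cons h _ ih => exact (hadj _ _ h).trans ih
  rw [SimpleGraph.connected_iff_exists_forall_reachable]
  refine ⟨some a, ?_⟩
  rintro (_ | x)
  exacts [ha.symm, hsome a x]

lemma vol_option [Fintype V] (H : SimpleGraph (Option V)) :
    vol H = ∑ x, ∑ y, wt H (some x) (some y) + 2 * ∑ x, wt H none (some x) := by
  simp only [vol, wdeg, Fintype.sum_option, wt_self, zero_add, Finset.sum_add_distrib]
  simp only [fun x => wt_symm H (some x) none]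
  ring

lemma vol_addPendent [Fintype V] (G : SimpleGraph V) (u : V) :
    vol (addPendent G u) = vol G + 2 := by
  classical
  have h1 : ∀ x y, wt (addPendent G u) (some x) (some y) = wt G x y := fun x y =>
    wt_congr (by simp [addPendent, SimpleGraph.edge_adj, map_some_adj])
  have h2 : ∀ x, wt (addPendent G u) none (some x) = if x = u then 1 else 0 := fun x => by
    simp [wt, addPendent, SimpleGraph.edge_adj, not_map_some_adj_none]
  rw [vol_option]
  simp [h1, h2, vol, wdeg]

lemma vol_subdivideEdge [Fintype V] {G : SimpleGraph V} {a b : V} (hab : G.Adj a b) :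
    vol (subdivideEdge G a b) = vol G + 2 := by
  classical
  have hne := hab.ne
  have h1 : ∀ x y, wt (subdivideEdge G a b) (some x) (some y)
      = wt G x y - ((if x = a then if y = b then 1 else 0 else 0)
        + if x = b then if y = a then 1 else 0 else 0) := fun x y => by
    have h : (subdivideEdge G a b).Adj (some x) (some y)
        ↔ G.Adj x y ∧ ¬ (x = a ∧ y = b ∨ x = b ∧ y = a) := by
      simp [subdivideEdge, SimpleGraph.edge_adj, map_some_adj, SimpleGraph.deleteEdges_adj]
    simp only [wt, h]
    have := hab.symm
    split_ifs <;> simp_all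
  have h2 : ∀ x, wt (subdivideEdge G a b) none (some x)
      = (if x = a then 1 else 0) + if x = b then 1 else 0 := fun x => by
    have h : (subdivideEdge G a b).Adj none (some x) ↔ x = a ∨ x = b := by
      simp [subdivideEdge, SimpleGraph.edge_adj, not_map_some_adj_none]
    simp only [wt, h]
    split_ifs <;> simp_all
  rw [vol_option]
  simp only [h1, h2, vol, wdeg, Finset.sum_sub_distrib, Finset.sum_add_distrib]
  simp
  ring

lemma IsGrowthStep.isTree {W : Type*} [Fintype V] [Fintype W] {G : SimpleGraph V} {v : V}
    {H : SimpleGraph W} {w : W} (h : IsGrowthStep G v H w) (hG : G.IsTree) :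
    H.IsTree ∧ Fintype.card W = Fintype.card V + 1 := by
  obtain ⟨hc, hv⟩ := (isTree_iff_vol G).1 hG
  have key : ∀ K : SimpleGraph (Option V), K.Connected → vol K = vol G + 2 → Nonempty (K ≃g H) →
      H.IsTree ∧ Fintype.card W = Fintype.card V + 1 := by
    rintro K hK hvK ⟨e⟩
    refine ⟨e.isTree_iff.1 ((isTree_iff_vol K).2 ⟨hK, ?_⟩), ?_⟩
    · rw [hvK, Fintype.card_option]; push_cast; linarith
    · rw [← e.card_eq, Fintype.card_option]
  rcases h with ⟨u, e, -⟩ | ⟨a, b, hab, e, -⟩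
  · exact key _ (connected_addPendent hc u) (vol_addPendent G u) ⟨e⟩
  · exact key _ (connected_subdivideEdge hc hab) (vol_subdivideEdge hab) ⟨e⟩

lemma IsGrowingTreeSequence.isTree {V : ℕ → Type*} [∀ n, Fintype (V n)]
    {T : ∀ n, SimpleGraph (V n)} {v : ∀ n, V n} (hT : IsGrowingTreeSequence T v) {n : ℕ}
    (hn : 1 ≤ n) : (T n).IsTree ∧ Fintype.card (V n) = n := by
  induction n, hn using Nat.le_induction with
  | base =>
    have : Subsingleton (V 1) := ⟨fun x y => (hT.1 x).trans (hT.1 y).symm⟩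
    have : Nonempty (V 1) := ⟨v 1⟩
    exact ⟨SimpleGraph.IsTree.of_subsingleton, Fintype.card_eq_one_iff.2 ⟨v 1, hT.1⟩⟩
  | succ n hn ih =>
    have := (hT.2 n hn).isTree ih.1
    rwa [ih.2] at this

end Growth

/-! ### The cubic lower bound -/

section LowerBound

variable {V : Type*}

/-- The far half of a geodesic consists of vertices whose Gromov products are large. -/
lemma exists_far_set {G : SimpleGraph V} (hG : G.Connected) (v u : V) :
    ∃ s : Finset V, (G.dist v u : ℝ) / 2 ≤ s.card ∧
      ∀ i ∈ s, ∀ j ∈ s, (G.dist v u : ℝ) ≤ rdist G i v + rdist G j v - rdist G j i := by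
  classical
  obtain ⟨p, hp⟩ := hG.exists_walk_length_eq_dist v u
  set l := G.dist v u
  have hstep : ∀ a t, G.dist (p.getVert a) (p.getVert (a + t)) ≤ t := by
    intro a t
    induction t with
    | zero => simp
    | succ t ih =>
      refine hG.dist_triangle.trans (add_le_add ih ?_)
      by_cases h : a + t < p.length
      · exact (SimpleGraph.dist_eq_one_iff_adj.mpr (p.adj_getVert_succ h)).le
      · rw [p.getVert_of_length_le (by omega), p.getVert_of_length_le (by omega)]
        simp
  have hdist : ∀ a ≤ l, G.dist (p.getVert a) v = a := by
    intro a ha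
    rw [SimpleGraph.dist_comm]
    have h1 := hstep 0 a
    have h2 := hstep a (l - a)
    rw [Nat.add_sub_cancel' ha, ← hp, p.getVert_length] at h2
    rw [p.getVert_zero, zero_add] at h1
    have h3 := hG.dist_triangle (u := v) (v := p.getVert a) (w := u)
    omega
  have hinj : Set.InjOn p.getVert (Finset.Icc ((l + 1) / 2) l) := by
    intro a ha b hb hab
    rw [Finset.coe_Icc, Set.mem_Icc] at ha hb
    rw [← hdist a ha.2, ← hdist b hb.2, hab]
  refine ⟨(Finset.Icc ((l + 1) / 2) l).image p.getVert, ?_, ?_⟩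
  · rw [Finset.card_image_of_injOn hinj, Nat.card_Icc, div_le_iff₀ (by norm_num)]
    exact_mod_cast (by omega : l ≤ (l + 1 - (l + 1) / 2) * 2)
  -- At positions `a ≤ b` on the geodesic the quantity is at least `a + b - (b - a) = 2 * a`, and
  -- `a` is at least `l / 2` rounded up.
  · have key : ∀ a b, a ≤ b → (l + 1) / 2 ≤ a → b ≤ l →
        (l : ℝ) ≤ rdist G (p.getVert a) v + rdist G (p.getVert b) v
          - rdist G (p.getVert a) (p.getVert b) := by
      intro a b hab ha hb
      have h1 := hstep a (b - a)
      rw [Nat.add_sub_cancel' hab] at h1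
      rw [rdist, rdist, rdist, hdist a (hab.trans hb), hdist b hb, le_sub_iff_add_le]
      exact_mod_cast (by omega)
    simp only [Finset.mem_image, Finset.mem_Icc]
    rintro _ ⟨a, ⟨ha, ha'⟩, rfl⟩ _ ⟨b, ⟨hb, hb'⟩, rfl⟩
    rcases le_total a b with hab | hab
    · rw [rdist, rdist, rdist, SimpleGraph.dist_comm (u := p.getVert b) (v := p.getVert a)]
      exact key a b hab ha hb'
    · rw [add_comm]
      exact key b a hab hb ha'

lemma exists_diam_le_two_mul_dist [Nonempty V] {G : SimpleGraph V} (hG : G.Connected) (v : V) :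
    ∃ u, G.diam ≤ 2 * G.dist v u := by
  obtain ⟨x, y, hxy⟩ := G.exists_dist_eq_diam
  have h := hG.dist_triangle (u := x) (v := v) (w := y)
  rw [SimpleGraph.dist_comm (u := x) (v := v), hxy] at h
  rcases le_total (G.dist v x) (G.dist v y) with h' | h'
  exacts [⟨y, by omega⟩, ⟨x, by omega⟩]

variable [Fintype V]

lemma two_mul_vol_mul_moment_sub_energy (G : SimpleGraph V) {R : V → V → ℝ} (v : V) :
    2 * vol G * moment G R v - energy G R
      = ∑ i, ∑ j, wdeg G j * wdeg G i * (R i v + R j v - R j i) := by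
  have h : ∀ i, ∑ j, wdeg G j * wdeg G i * (R i v + R j v - R j i)
      = vol G * (wdeg G i * R i v) + wdeg G i * moment G R v - wdeg G i * moment G R i := fun i => by
    rw [moment, moment, vol, Finset.sum_mul, Finset.mul_sum, Finset.mul_sum,
      ← Finset.sum_add_distrib, ← Finset.sum_sub_distrib]
    exact Finset.sum_congr rfl fun j _ => by ring
  simp only [h, Finset.sum_sub_distrib, Finset.sum_add_distrib, ← Finset.mul_sum, ← Finset.sum_mul]
  rw [← moment, ← vol, ← energy]
  ring

lemma one_le_wdeg [Nontrivial V] {G : SimpleGraph V} (hG : G.Connected) (i : V) :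
    1 ≤ wdeg G i := by
  obtain ⟨j, hj⟩ := exists_ne i
  obtain ⟨k, hk, -⟩ := exists_adj_dist hG hj.symm
  exact one_le_wdeg_of_adj hk

/-- The far half of a geodesic gives at least `(l / 2)²` ordered pairs, each contributing at least
`l` because degrees are at least 1; all other pairs contribute nonnegatively. -/
lemma dist_cube_le {G : SimpleGraph V} [Nontrivial V] (hG : G.Connected) (v u : V) :
    (G.dist v u : ℝ) ^ 3 / 4 ≤ 2 * vol G * moment G (rdist G) v - energy G (rdist G) := by
  obtain ⟨s, hs, h⟩ := exists_far_set hG v u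
  set l : ℝ := (G.dist v u : ℝ)
  have hl : 0 ≤ l := Nat.cast_nonneg _
  have hterm : ∀ i j, 0 ≤ wdeg G j * wdeg G i * (rdist G i v + rdist G j v - rdist G j i) := by
    intro i j
    refine mul_nonneg (mul_nonneg (wdeg_nonneg G j) (wdeg_nonneg G i)) (sub_nonneg.2 ?_)
    have := hG.dist_triangle (u := j) (v := v) (w := i)
    rw [SimpleGraph.dist_comm (u := v)] at this
    rw [rdist, rdist, rdist, add_comm]
    exact_mod_cast this
  rw [two_mul_vol_mul_moment_sub_energy]
  calc l ^ 3 / 4 = l / 2 * (l / 2) * l := by ring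
    _ ≤ s.card * s.card * l := by gcongr
    _ = ∑ i ∈ s, ∑ j ∈ s, l := by simp [mul_assoc]
    _ ≤ ∑ i ∈ s, ∑ j ∈ s, wdeg G j * wdeg G i * (rdist G i v + rdist G j v - rdist G j i) := by
        refine Finset.sum_le_sum fun i hi => Finset.sum_le_sum fun j hj => ?_
        refine (h i hi j hj).trans (le_mul_of_one_le_left (hl.trans (h i hi j hj)) ?_)
        exact one_le_mul_of_one_le_of_one_le (one_le_wdeg hG j) (one_le_wdeg hG i)
    _ ≤ ∑ i ∈ s, ∑ j, wdeg G j * wdeg G i * (rdist G i v + rdist G j v - rdist G j i) :=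
        Finset.sum_le_sum fun i _ =>
          Finset.sum_le_univ_sum_of_nonneg fun j => hterm i j
    _ ≤ _ := Finset.sum_le_univ_sum_of_nonneg fun i => Finset.sum_nonneg fun j _ => hterm i j

lemma diam_cube_le {G : SimpleGraph V} [Nontrivial V] (hG : G.Connected) (v : V) :
    (G.diam : ℝ) ^ 3 / 32 ≤ 2 * vol G * moment G (rdist G) v - energy G (rdist G) := by
  obtain ⟨u, hu⟩ := exists_diam_le_two_mul_dist hG v
  have hu' : (G.diam : ℝ) ≤ 2 * G.dist v u := by exact_mod_cast hu
  have h3 : (G.diam : ℝ) ^ 3 ≤ (2 * G.dist v u) ^ 3 := by gcongr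
  have := dist_cube_le hG v u
  nlinarith

end LowerBound

/-! ### Comparing Kemeny's constants -/

section Comparison

variable {V W : Type*} [Fintype V] [Fintype W]

/-- Replacing the second graph of a gluing by one with an additional edge increases Kemeny's
constant if the Gromov products of the first graph at the gluing vertex are large. -/
lemma IsGluing.kemeny_lt {Γ Γ' : SimpleGraph (V ⊕ W)} {G : SimpleGraph V} {v : V}
    {H H' : SimpleGraph (Option W)} (h : IsGluing Γ G v H) (h' : IsGluing Γ' G v H')
    {R : V → V → ℝ} {S S' : Option W → Option W → ℝ} (hR : IsResistance G R)
    (hS : IsResistance H S) (hS' : IsResistance H' S') (hG : ∀ x, 0 < wdeg G x)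
    (hH : ∀ w, 0 < wdeg H w) (hH' : ∀ w, 0 < wdeg H' w) (hvol : vol H' = vol H + 2)
    (hlt : (vol G + vol H + 2) * (energy H S + 2 * vol G * moment H S none)
      < 2 * (2 * vol G * moment G R v - energy G R)) :
    ∃ K K' : ℝ≥0, IsKemenyConstant (walkMatrix Γ) K ∧ IsKemenyConstant (walkMatrix Γ') K' ∧
      K < K' := by
  have hvG : 0 < vol G := Finset.sum_pos (fun x _ => hG x) ⟨v, Finset.mem_univ _⟩
  have hvH : 0 ≤ vol H := vol_nonneg H
  have e1 := hS'.energy_nonneg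
  have e2 := hS'.moment_nonneg none
  refine ⟨_, _, (h.isResistance hR hS).isKemenyConstant (h.wdeg_pos hG hH) ?_,
    (h'.isResistance hR hS').isKemenyConstant (h'.wdeg_pos hG hH') ?_, ?_⟩
  · rw [h.vol_eq]; linarith
  · rw [h'.vol_eq]; linarith
  have hnn : 0 ≤ energy Γ (glueResistance R v S) / (2 * vol Γ) :=
    div_nonneg (h.isResistance hR hS).energy_nonneg (by linarith [vol_nonneg Γ])
  rw [Real.toNNReal_lt_toNNReal_iff_of_nonneg hnn, h.vol_eq, h'.vol_eq, h.energy_eq hR hS,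
    h'.energy_eq hR hS', hvol, div_lt_div_iff₀ (by linarith) (by linarith)]
  -- The contribution of the closed piece only helps and is discarded.
  have e3 : 0 ≤ (vol G + vol H) * (energy H' S' + 2 * vol G * moment H' S' none) := by positivity
  linear_combination 2 * hlt + 2 * e3

end Comparison

/-! ### Growth rates -/

section Asymptotics

/-- A quadratic bound is eventually beaten by the cube of a sequence that grows faster than
`n ^ (2 / 3)`. -/
lemma eventually_mul_sq_le_cube {d : ℕ → ℝ}
    (hd : (fun n : ℕ => (n : ℝ) ^ (2 / 3 : ℝ)) =o[Filter.atTop] d) (hd0 : ∀ n, 0 ≤ d n) {K : ℝ}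
    (hK : 1 ≤ K) : ∀ᶠ n : ℕ in Filter.atTop, K * (n : ℝ) ^ 2 ≤ d n ^ 3 := by
  filter_upwards [hd.def (inv_pos.2 (zero_lt_one.trans_le hK))] with n hn
  have hK0 : 0 < K := zero_lt_one.trans_le hK
  rw [Real.norm_of_nonneg (by positivity), Real.norm_of_nonneg (hd0 n)] at hn
  have h1 : ((n : ℝ) ^ (2 / 3 : ℝ)) ^ 3 = (n : ℝ) ^ 2 := by
    rw [← Real.rpow_natCast, ← Real.rpow_mul (Nat.cast_nonneg n), ← Real.rpow_natCast]
    norm_num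
  have h2 : K * (n : ℝ) ^ (2 / 3 : ℝ) ≤ d n := by
    rwa [inv_mul_eq_div, le_div_iff₀ hK0, mul_comm] at hn
  calc K * (n : ℝ) ^ 2 ≤ K ^ 3 * (n : ℝ) ^ 2 := by
        gcongr
        exact le_self_pow₀ hK (by norm_num)
    _ = (K * (n : ℝ) ^ (2 / 3 : ℝ)) ^ 3 := by rw [mul_pow, h1]
    _ ≤ d n ^ 3 := by gcongr

end Asymptotics

end Kemeny

end

theorem corollary5p2 {V : ℕ → Type*} [∀ n, Fintype (V n)]
    (T : ∀ n, SimpleGraph (V n)) (v : ∀ n, V n)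
    (hT : Kemeny.IsGrowingTreeSequence T v)
    (hdiam : (fun n : ℕ => (n : ℝ) ^ (2 / 3 : ℝ)) =o[Filter.atTop]
      (fun n : ℕ => ((T n).diam : ℝ))) :
    Kemeny.AsymptoticallyParadoxical T v := by
  intro k₁ k₂ hk
  have hP := (Kemeny.isResistance_pathGraph (k₁ + k₂)).comap (Kemeny.twinEquiv k₁ k₂)
  have hC := (Kemeny.isResistance_closedPath hk).comap (Kemeny.twinEquiv k₁ k₂)
  have hF := hP.energy_nonneg
  have hS := hP.moment_nonneg none
  set P := (SimpleGraph.pathGraph (k₁ + k₂ + 1)).comap (Kemeny.twinEquiv k₁ k₂) with hPdef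
  set F := Kemeny.energy P _
  set S := Kemeny.moment P _ none
  have hp : 0 ≤ Kemeny.vol P := Kemeny.vol_nonneg P
  -- The factor 16 turns twice the bound `diam³ / 32` into `diam³`; the summand 1 makes the final
  -- inequality strict and the constant at least 1.
  have hK : 1 ≤ 16 * ((4 + Kemeny.vol P) * (F + 4 * S)) + 1 := by
    have : 0 ≤ (4 + Kemeny.vol P) * (F + 4 * S) := by positivity
    linarith
  obtain ⟨N, hN⟩ := Filter.eventually_atTop.1
    (Kemeny.eventually_mul_sq_le_cube hdiam (fun n => Nat.cast_nonneg _) hK)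
  -- At least two vertices are needed for positive degrees in the tree.
  refine ⟨N + 2, by omega, fun n hn => ?_⟩
  obtain ⟨htree, hcard⟩ := hT.isTree (n := n) (by omega)
  have hnt : Nontrivial (V n) := Fintype.one_lt_card_iff_nontrivial.1 (by omega)
  have hconn := htree.connected
  refine (Kemeny.isGluing_twinPaths (T n) (v n) k₁ k₂).kemeny_lt
    (Kemeny.isGluing_twinPathsClosed (T n) (v n) hk) (Kemeny.isResistance_rdist htree) hP hC
    (fun x => zero_lt_one.trans_le (Kemeny.one_le_wdeg hconn x)) (fun w => ?_) (fun w => ?_) ?_ ?_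
  · rw [Kemeny.wdeg_comap]; exact Kemeny.wdeg_pathGraph_pos (by omega) _
  · rw [Kemeny.wdeg_comap]; exact Kemeny.wdeg_closedPath_pos hk _
  · rw [Kemeny.vol_comap, Kemeny.vol_comap, Kemeny.vol_closedPath hk]
  have hvol : Kemeny.vol (T n) + 2 = 2 * (n : ℝ) := by
    have := ((Kemeny.isTree_iff_vol (T n)).1 htree).2
    rwa [hcard] at this
  have hd := Kemeny.diam_cube_le hconn (v n)
  have hcube := hN n (by omega)
  have hn1 : (1 : ℝ) ≤ n := by exact_mod_cast (by omega : 1 ≤ n)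
  have hv0 := Kemeny.vol_nonneg (T n)
  -- With `vol (T n) = 2 * n - 2` and `1 ≤ n`, each factor is at most linear in `n`.
  have hle : (Kemeny.vol (T n) + Kemeny.vol P + 2) * (F + 2 * Kemeny.vol (T n) * S)
      ≤ ((4 + Kemeny.vol P) * n) * ((F + 4 * S) * n) := by
    apply mul_le_mul
    · nlinarith
    · nlinarith [mul_nonneg hS hv0]
    · positivity
    · positivity
  have hsq : (0 : ℝ) < (n : ℝ) ^ 2 := by positivity
  nlinarith
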